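/- Let $V$ be a simple vertex operator algebra over $\mathbb{C}$ (with $\mathbb{Z}$-grading $V=\bigoplus_{n} V_n$ by $L(0)$-eigenvalues, $\dim V_n<\infty$, and $V_n=0$ for $n$ sufficiently small), and let $g$ be an automorphism of $V$ of finite order $|g|$. Write $V^{\langle g\rangle}=\{a\in V\mid ga=a\}$ for the fixed-point vertex operator subalgebra (orbifold). If $V^{\langle g\rangle}$ is rational, then $V$ is $g$-rational. Here an admissible $g$-twisted $V$-module is a weak $g$-twisted $V$-module $M$ (with $Y_M(a,z)=\sum_{n\in r/|g|+\mathbb{Z}}a_{(n)}z^{-n-1}$ when $ga=e^{2\pi i r/|g|}a$) equipped with a grading $M=\bigoplus_{n\in\frac{1}{|g|}\mathbb{Z}_{\ge 0}}M(n)$ such that $a_{(m)}M(n)\subseteq M(n+\mathrm{wt}(a)-m-1)$ for all homogeneous $a\in V$ and all $m$. A vertex operator algebra $V$ is called $g$-rational if every admissible $g$-twisted $V$-module is a direct sum of irreducible admissible $g$-twisted $V$-modules, and rational if it is $1$-rational. -/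

import Mathlib

universe u v

noncomputable section

open VertexOperator

/-- A vertex operator algebra over `ℂ`. The vertex operators are
`Y(a, z) = ∑ a_(n) z ^ (-n-1)` with `a_(n) = ncoeff (Y a) n`; the field property (`a_(n) b = 0` for
`n` large) is part of Mathlib's `VertexOperator`. -/
structure VertexOperatorAlgebra (V : Type u) [AddCommGroup V] [Module ℂ V] where
  /-- the state-field correspondence -/
  Y : V →ₗ[ℂ] VertexOperator ℂ V
  /-- the vacuum vector -/
  vac : V
  /-- the conformal (Virasoro) vector -/
  conf : V
  /-- the central charge -/
  c : ℂ
  /-- `Y(𝟙, z) = id` -/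
  vac_apply : ∀ (n : ℤ) (a : V), ncoeff (Y vac) n a = if n = -1 then a else 0
  /-- `Y(a, z) 𝟙` is regular at `z = 0` … -/
  apply_vac_of_nonneg : ∀ (a : V) (n : ℤ), 0 ≤ n → ncoeff (Y a) n vac = 0
  /-- … with constant term `a` -/
  apply_vac : ∀ a : V, ncoeff (Y a) (-1) vac = a
  /-- The Jacobi identity: equality of the coefficients of
  `z₀ ^ (-k-1) z₁ ^ (-m-1) z₂ ^ (-n-1)` for all `k m n`. All sums are finite. -/
  jacobi : ∀ (a b w : V) (k m n : ℤ),
    ∑ᶠ i : ℕ, ((Ring.choose m i : ℤ) : ℂ) • ncoeff (Y (ncoeff (Y a) (k + i) b)) (m + n - i) w =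
      ∑ᶠ i : ℕ, ((-1) ^ i * ((Ring.choose k i : ℤ) : ℂ)) •
        (ncoeff (Y a) (m + k - i) (ncoeff (Y b) (n + i) w) -
          (-1 : ℂ) ^ k • ncoeff (Y b) (n + k - i) (ncoeff (Y a) (m + i) w))
  /-- The Virasoro relations for `L(n) = ω_(n+1)`. -/
  virasoro : ∀ (m n : ℤ) (a : V),
    ncoeff (Y conf) (m + 1) (ncoeff (Y conf) (n + 1) a) -
        ncoeff (Y conf) (n + 1) (ncoeff (Y conf) (m + 1) a) =
      ((m : ℂ) - n) • ncoeff (Y conf) (m + n + 1) a +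
        (if m + n = 0 then (((m : ℂ) ^ 3 - m) / 12 * c) • a else 0)
  /-- `Y(L(-1) a, z) = d/dz Y(a, z)` -/
  translation : ∀ (a b : V) (n : ℤ),
    ncoeff (Y (ncoeff (Y conf) 0 a)) n b = (-(n : ℂ)) • ncoeff (Y a) (n - 1) b
  /-- `V` is the sum (automatically direct) of the eigenspaces `V_n` of `L(0)`, `n ∈ ℤ`. -/
  iSup_weight : ⨆ n : ℤ, (ncoeff (Y conf) 1).eigenspace (n : ℂ) = ⊤
  /-- `dim V_n < ∞` -/
  finite_weight : ∀ n : ℤ, FiniteDimensional ℂ ((ncoeff (Y conf) 1).eigenspace (n : ℂ))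
  /-- `V_n = 0` for `n` sufficiently small -/
  bounded_weight : ∃ N : ℤ, ∀ n < N, (ncoeff (Y conf) 1).eigenspace (n : ℂ) = ⊥

namespace VertexOperatorAlgebra

variable {V : Type u} [AddCommGroup V] [Module ℂ V] (A : VertexOperatorAlgebra V)

/-- The `n`-th product `a_(n) b`. -/
def mode (a : V) (n : ℤ) : Module.End ℂ V := ncoeff (A.Y a) n

/-- The space `V_n` of vectors of weight `n`. -/
def weight (n : ℤ) : Submodule ℂ V := (A.mode A.conf 1).eigenspace (n : ℂ)

/-- A vertex operator algebra is simple if it is nonzero and has no ideals except `0` and `V`,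
that is, if it is irreducible as a module over itself. -/
def IsSimple : Prop :=
  Nontrivial V ∧ ∀ I : Submodule ℂ V,
    (∀ (a : V) (n : ℤ), ∀ x ∈ I, A.mode a n x ∈ I) → I = ⊥ ∨ I = ⊤

/-- The automorphism group of a vertex operator algebra: linear automorphisms preserving all
products, the vacuum and the conformal vector. -/
def aut : Subgroup (V ≃ₗ[ℂ] V) where
  carrier := {g | (∀ (a b : V) (n : ℤ), g (A.mode a n b) = A.mode (g a) n (g b)) ∧
    g A.vac = A.vac ∧ g A.conf = A.conf}
  one_mem' := ⟨fun _ _ _ => rfl, rfl, rfl⟩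
  mul_mem' := by
    rintro g h ⟨hg, hg1, hg2⟩ ⟨hh, hh1, hh2⟩
    refine ⟨fun a b n => ?_, ?_, ?_⟩
    · simp only [LinearEquiv.mul_apply, hh, hg]
    · simp only [LinearEquiv.mul_apply, hh1, hg1]
    · simp only [LinearEquiv.mul_apply, hh2, hg2]
  inv_mem' := by
    rintro g ⟨hg, hg1, hg2⟩
    have key : ∀ x y : V, g⁻¹ x = y ↔ x = g y := fun x y => LinearEquiv.symm_apply_eq g
    have key' : ∀ x : V, g (g⁻¹ x) = x := fun x => LinearEquiv.apply_symm_apply g x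
    refine ⟨fun a b n => ?_, ?_, ?_⟩
    · rw [key, hg, key', key']
    · rw [key, hg1]
    · rw [key, hg2]

/-- The subspace `V^G` of vectors fixed by a group `G` of automorphisms. -/
def fixed (G : Subgroup A.aut) : Submodule ℂ V where
  carrier := {a | ∀ h ∈ G, (h : V ≃ₗ[ℂ] V) a = a}
  zero_mem' := fun _ _ => map_zero _
  add_mem' := fun ha hb h hh => by rw [map_add, ha h hh, hb h hh]
  smul_mem' := fun c a ha h hh => by rw [map_smul, ha h hh]

variable {A} in
theorem ncoeff_mem_fixed {G : Subgroup A.aut} {a b : V} (ha : a ∈ A.fixed G) (n : ℤ)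
    (hb : b ∈ A.fixed G) : ncoeff (A.Y a) n b ∈ A.fixed G := by
  intro h hh
  have := h.2.1 a b n
  rw [ha h hh, hb h hh] at this
  exact this

/-- The restriction to `V^G` of the vertex operators of elements of `V^G`. -/
def orbifoldY (G : Subgroup A.aut) :
    A.fixed G →ₗ[ℂ] VertexOperator ℂ (A.fixed G) where
  toFun a := HVertexOperator.of_coeff
    (fun k => (HVertexOperator.coeff (A.Y a) k).restrict (p := A.fixed G) (q := A.fixed G)
      fun b hb => by
        rw [coeff_eq_ncoeff]; exact ncoeff_mem_fixed a.2 _ hb)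
    (fun b => by
      refine (HVertexOperator.coeff_isPWOsupport (A.Y a) (b : V)).mono ?_
      intro k hk h0
      exact hk (Subtype.ext h0))
  map_add' a b := by
    apply HVertexOperator.coeff_inj
    ext k w
    change HVertexOperator.coeff (A.Y ((a : V) + b)) k (w : V) =
      HVertexOperator.coeff (A.Y (a : V)) k w + HVertexOperator.coeff (A.Y (b : V)) k w
    rw [map_add, map_add]
    rfl
  map_smul' c a := by
    apply HVertexOperator.coeff_inj
    ext k w
    change HVertexOperator.coeff (A.Y (c • (a : V))) k (w : V) =
      c • HVertexOperator.coeff (A.Y (a : V)) k w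
    rw [map_smul, map_smul]
    rfl

theorem orbifoldY_apply (G : Subgroup A.aut) (a b : A.fixed G) (n : ℤ) :
    ((ncoeff (A.orbifoldY G a) n b : A.fixed G) : V) = ncoeff (A.Y (a : V)) n (b : V) := rfl

theorem coe_finsum {p : Submodule ℂ V} (f : ℕ → p) :
    ((∑ᶠ i, f i : p) : V) = ∑ᶠ i, (f i : V) :=
  AddMonoidHom.map_finsum_of_injective p.subtype.toAddMonoidHom p.injective_subtype f

/-- If a `G`-fixed vector is a sum of weight vectors then so are its pieces. -/
theorem orbifold_iSup_weight (G : Subgroup A.aut) (T : Module.End ℂ (A.fixed G))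
    (hT : ∀ b : A.fixed G, ((T b : A.fixed G) : V) = ncoeff (A.Y A.conf) 1 (b : V)) :
    ⨆ n : ℤ, T.eigenspace (n : ℂ) = ⊤ := by
  classical
  set E : ℤ → Submodule ℂ V := fun n => (ncoeff (A.Y A.conf) 1).eigenspace (n : ℂ) with hE
  have hind : iSupIndep E :=
    (Module.End.eigenspaces_iSupIndep (ncoeff (A.Y A.conf) 1)).comp (Int.cast_injective (α := ℂ))
  rw [eq_top_iff]
  rintro ⟨x, hx⟩ -
  have hx' : x ∈ ⨆ n, E n := by rw [hE, A.iSup_weight]; trivial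
  obtain ⟨f, hf, rfl⟩ := (Submodule.mem_iSup_iff_exists_finsupp E x).1 hx'
  have hfix : ∀ n, f n ∈ A.fixed G := by
    intro n h hh
    by_cases hn : n ∈ f.support
    · have hmem : ∀ i, (h : V ≃ₗ[ℂ] V) (f i) - f i ∈ E i := by
        intro i
        refine Submodule.sub_mem _ ?_ (hf i)
        have h1 := Module.End.mem_eigenspace_iff.1 (hf i)
        refine Module.End.mem_eigenspace_iff.2 ?_
        have h2 := h.2.1 A.conf (f i) 1
        rw [h.2.2.2] at h2
        change (A.mode A.conf 1) _ = _
        rw [← h2]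
        change (h : V ≃ₗ[ℂ] V) (ncoeff (A.Y A.conf) 1 (f i)) = _
        rw [h1, map_smul]
      have hsum : ∑ i ∈ f.support, ((h : V ≃ₗ[ℂ] V) (f i) - f i) = 0 := by
        rw [Finset.sum_sub_distrib, ← map_sum, sub_eq_zero]
        exact hx h hh
      exact sub_eq_zero.1
        ((iSupIndep_iff_finsetSum_eq_zero_imp_eq_zero E).1 hind f.support
          (fun i => (h : V ≃ₗ[ℂ] V) (f i) - f i) (fun i _ => hmem i) hsum n hn)
    · rw [Finsupp.notMem_support_iff.1 hn, map_zero]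
  have : (⟨f.sum fun _ y => y, hx⟩ : A.fixed G) = ∑ i ∈ f.support, ⟨f i, hfix i⟩ := by
    apply Subtype.ext
    rw [AddSubmonoidClass.coe_finsetSum]
    rfl
  rw [this]
  refine Submodule.sum_mem _ fun i _ => Submodule.mem_iSup_of_mem i ?_
  refine Module.End.mem_eigenspace_iff.2 (Subtype.ext ?_)
  rw [hT]
  exact Module.End.mem_eigenspace_iff.1 (hf i)

/-- The orbifold `V^G`: the fixed-point subspace with the restricted vertex operators and the same
vacuum, conformal vector and central charge. -/
def orbifold (G : Subgroup A.aut) : VertexOperatorAlgebra (A.fixed G) where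
  Y := A.orbifoldY G
  vac := ⟨A.vac, fun h _ => h.2.2.1⟩
  conf := ⟨A.conf, fun h _ => h.2.2.2⟩
  c := A.c
  vac_apply n a := by
    apply Subtype.ext
    rw [orbifoldY_apply, A.vac_apply]
    split_ifs <;> rfl
  apply_vac_of_nonneg a n hn := Subtype.ext (A.apply_vac_of_nonneg a n hn)
  apply_vac a := Subtype.ext (A.apply_vac a)
  jacobi a b w k m n := by
    apply Subtype.ext
    rw [coe_finsum, coe_finsum]
    exact A.jacobi a b w k m n
  virasoro m n a := by
    apply Subtype.ext
    have := A.virasoro m n a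
    rw [Submodule.coe_add, apply_ite Subtype.val]
    exact this
  translation a b n := Subtype.ext (A.translation a b n)
  iSup_weight := A.orbifold_iSup_weight G _ fun _ => rfl
  finite_weight n := by
    have := A.finite_weight n
    refine FiniteDimensional.of_injective
      (LinearMap.restrict (p := Module.End.eigenspace _ (n : ℂ))
        (q := (ncoeff (A.Y A.conf) 1).eigenspace (n : ℂ)) (A.fixed G).subtype fun x hx => ?_) ?_
    · exact Module.End.mem_eigenspace_iff.2
        (congrArg Subtype.val (Module.End.mem_eigenspace_iff.1 hx))
    · intro x y hxy
      have h := congrArg Subtype.val hxy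
      exact Subtype.ext (Subtype.ext h)
  bounded_weight := by
    obtain ⟨N, hN⟩ := A.bounded_weight
    refine ⟨N, fun n hn => (Submodule.eq_bot_iff _).2 fun x hx => Subtype.ext ?_⟩
    have h1 : (x : V) ∈ (ncoeff (A.Y A.conf) 1).eigenspace (n : ℂ) :=
      Module.End.mem_eigenspace_iff.2
        (congrArg Subtype.val (Module.End.mem_eigenspace_iff.1 hx))
    rw [hN n hn] at h1
    exact (Submodule.mem_bot ℂ).1 h1

/-- The eigenspace `V^r = {a | g a = exp(2πi r / |g|) a}` of an automorphism `g` of finite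
order. -/
def eigen (g : A.aut) (r : ℕ) : Submodule ℂ V :=
  Module.End.eigenspace (g : V ≃ₗ[ℂ] V).toLinearMap
    (Complex.exp (2 * Real.pi * Complex.I * r / orderOf g))

/-- A weak `g`-twisted `V`-module structure on `W`, for an automorphism `g` of finite order `|g|`:
`Y_W(a, z) = ∑ a_(q) z ^ (-q-1)`, the sum over rational `q`, with `a_(q) = act q a`. -/
structure WeakTwistedModule (g : A.aut) (W : Type v) [AddCommGroup W] [Module ℂ W] where
  /-- the modes `a_(q)` -/
  act : ℚ → V →ₗ[ℂ] Module.End ℂ W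
  /-- for `a ∈ V^r` only modes `a_(q)` with `q ∈ r / |g| + ℤ` occur -/
  act_eq_zero : ∀ r < orderOf g, ∀ a ∈ A.eigen g r, ∀ q : ℚ,
    (¬ ∃ n : ℤ, q = n + (r : ℚ) / orderOf g) → act q a = 0
  /-- `a_(q) w = 0` for `q` sufficiently large -/
  truncation : ∀ (a : V) (w : W), ∃ N : ℚ, ∀ q ≥ N, act q a w = 0
  /-- `Y_W(𝟙, z) = id` -/
  vac_act : ∀ (q : ℚ) (w : W), act q A.vac w = if q = -1 then w else 0
  /-- The twisted Jacobi identity for `a ∈ V^r` and `b ∈ V`,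
  `z₀⁻¹ δ((z₁-z₂)/z₀) Y(a,z₁) Y(b,z₂) - z₀⁻¹ δ((-z₂+z₁)/z₀) Y(b,z₂) Y(a,z₁)
    = z₂⁻¹ δ((z₁-z₀)/z₂) ((z₁-z₀)/z₂) ^ (-r/|g|) Y(Y(a,z₀)b,z₂)`:
  equality of the coefficients of `z₀ ^ (-k-1) z₁ ^ (-m-1) z₂ ^ (-n-1)`. Only exponents with
  `m ∈ r / |g| + ℤ` occur on either side. All sums are finite. -/
  jacobi : ∀ r < orderOf g, ∀ a ∈ A.eigen g r, ∀ (b : V) (w : W) (k : ℤ) (m n : ℚ),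
    (∃ l : ℤ, m = l + (r : ℚ) / orderOf g) →
    ∑ᶠ i : ℕ, ((Ring.choose m i : ℚ) : ℂ) • act (m + n - i) (A.mode a (k + i) b) w =
      ∑ᶠ i : ℕ, ((-1) ^ i * ((Ring.choose k i : ℤ) : ℂ)) •
        (act (m + k - i) a (act (n + i) b w) -
          (-1 : ℂ) ^ k • act (n + k - i) b (act (m + i) a w))

/-- An admissible `g`-twisted `V`-module: a weak one with a grading
`W = ⨁ W(n)`, `n ∈ (1/|g|) ℕ`, such that `a_(q) W(n) ⊆ W(n + wt a - q - 1)`. The grading is indexed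
by `ℚ`, with `W(n) = 0` for `n` outside `(1/|g|) ℕ`. -/
structure AdmissibleTwistedModule (g : A.aut) (W : Type v) [AddCommGroup W] [Module ℂ W]
    extends WeakTwistedModule A g W where
  /-- the graded pieces `W(n)` -/
  grade : ℚ → Submodule ℂ W
  isInternal_grade : DirectSum.IsInternal grade
  grade_eq_bot : ∀ n : ℚ, (¬ ∃ k : ℕ, n = (k : ℚ) / orderOf g) → grade n = ⊥
  act_mem_grade : ∀ (d : ℤ), ∀ a ∈ A.weight d, ∀ (q n : ℚ), ∀ w ∈ grade n,
    act q a w ∈ grade (n + d - q - 1)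

namespace AdmissibleTwistedModule

variable {A} {g : A.aut} {W : Type v} [AddCommGroup W] [Module ℂ W]
  (M : AdmissibleTwistedModule A g W)

/-- Admissible submodules: graded subspaces stable under all modes. -/
structure IsSubmodule (N : Submodule ℂ W) : Prop where
  act_mem : ∀ (q : ℚ) (a : V), ∀ w ∈ N, M.act q a w ∈ N
  graded : N = ⨆ n : ℚ, N ⊓ M.grade n

/-- An admissible submodule that is irreducible as an admissible module. -/
structure IsIrreducibleSubmodule (N : Submodule ℂ W) : Prop where
  isSubmodule : M.IsSubmodule N
  ne_bot : N ≠ ⊥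
  eq_bot_or_eq : ∀ N' ≤ N, M.IsSubmodule N' → N' = ⊥ ∨ N' = N

/-- `M` is the (internal) direct sum of a family of irreducible admissible submodules. -/
def IsCompletelyReducible : Prop :=
  ∃ S : Set (Submodule ℂ W),
    (∀ N ∈ S, M.IsIrreducibleSubmodule N) ∧ sSupIndep S ∧ sSup S = ⊤

end AdmissibleTwistedModule

/-- `V` is `g`-rational if every admissible `g`-twisted `V`-module is a direct sum of irreducible
admissible `g`-twisted `V`-modules. -/
def IsTwistedRational (g : A.aut) : Prop :=
  ∀ (W : Type v) [AddCommGroup W] [Module ℂ W] (M : AdmissibleTwistedModule A g W),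
    M.IsCompletelyReducible

/-- A vertex operator algebra is rational if it is `1`-rational. -/
def IsRational : Prop := IsTwistedRational.{u, v} A 1

end VertexOperatorAlgebra

end

/-! Write `T` for the order of `g`, let `V^r` be the eigenspaces of `g`, and let `W⁰` be the sum of
the graded pieces of `W` in integral degrees. A vector of `V^r` changes degrees by `-r/T` modulo
`ℤ`, so `W⁰` is an untwisted admissible `V^g`-module and hence completely reducible. Semisimplicity
passes to `W` because `X ↦ gen X` and `N ↦ N ∩ W⁰` match graded `V^g`-submodules of `W⁰` with graded
`V`-submodules of `W`.

In one direction, `gen X ∩ W⁰ = X` (`gen_inf_integralPart`): modes from `V^r` with `0 < r < T` leave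
the integral degrees. In the other, `N` is generated by `N ∩ W⁰`
(`IsSubmodule.le_gen_inf_integralPart`): for `x ∈ N` of degree `k/T`, take a nonzero `a ∈ V^r` with
`r ≡ k` modulo `T`; all `a_(q) x` lie in `N ∩ W⁰`, and they suffice to recover `x`.

This last point uses simplicity twice. The vectors of `V` annihilating a module modulo a submodule
form an ideal, so a nonzero `a` cannot send `x` into a submodule that omits `x`
(`mem_of_forall_act_mem`). It follows that products of nonzero eigenvectors do not vanish, so the
eigenvalues of `g` form a group, which must be all the `T`-th roots of unity (`eigen_ne_bot`). -/

noncomputable section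

open VertexOperator

/-! ### Operators of finite order -/

namespace Module.End

variable {V : Type*} [AddCommGroup V] [Module ℂ V]

/-- The averaged sum `∑ μ⁻ʲ fʲ v` is an eigenvector of an operator `f` of finite order. -/
theorem sum_inv_pow_smul_mem_eigenspace (f : Module.End ℂ V) {T : ℕ} (hf : f ^ T = 1) {μ : ℂ}
    (hμ : μ ^ T = 1) (hμ0 : μ ≠ 0) (v : V) :
    ∑ j ∈ Finset.range T, (μ⁻¹ ^ j) • (f ^ j) v ∈ f.eigenspace μ := by
  have h1 : ∀ j, f ((μ⁻¹ ^ j) • (f ^ j) v) = μ • ((μ⁻¹ ^ (j + 1)) • (f ^ (j + 1)) v) := by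
    intro j
    rw [map_smul, smul_smul, pow_succ' f, pow_succ', ← mul_assoc, mul_inv_cancel₀ hμ0, one_mul]
    rfl
  -- Splitting off the last or the first of `T + 1` terms leaves equal sums: the terms `j = T` and
  -- `j = 0` agree since `f ^ T = 1` and `μ ^ T = 1`.
  have h2 := (Finset.sum_range_succ (fun j => (μ⁻¹ ^ j) • (f ^ j) v) T).symm.trans
    (Finset.sum_range_succ' (fun j => (μ⁻¹ ^ j) • (f ^ j) v) T)
  rw [hf, inv_pow, hμ, pow_zero, pow_zero, inv_one] at h2
  rw [Module.End.mem_eigenspace_iff, map_sum, Finset.sum_congr rfl fun j _ => h1 j,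
    ← Finset.smul_sum, add_right_cancel h2]

/-- An operator of finite order is diagonalizable. -/
theorem eq_top_of_eigenspace_le (f : Module.End ℂ V) {T : ℕ} (hT : T ≠ 0) (hf : f ^ T = 1) {ζ : ℂ}
    (hζ : IsPrimitiveRoot ζ T) (S : Submodule ℂ V) (hS : ∀ r < T, f.eigenspace (ζ ^ r) ≤ S) :
    S = ⊤ := by
  rw [eq_top_iff]
  rintro v -
  -- The unnormalized projections to the eigenspaces add up to `T • v`, by orthogonality of the
  -- characters of `ℤ/T`.
  have h1 : ∑ r ∈ Finset.range T, ∑ j ∈ Finset.range T, (((ζ ^ r)⁻¹) ^ j) • (f ^ j) v ∈ S := by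
    refine Submodule.sum_mem _ fun r hr => hS r (Finset.mem_range.1 hr) ?_
    refine sum_inv_pow_smul_mem_eigenspace f hf ?_ (pow_ne_zero _ (hζ.ne_zero hT)) v
    rw [← pow_mul, mul_comm, pow_mul, hζ.pow_eq_one, one_pow]
  have h2 : ∀ j ∈ Finset.range T, ∑ r ∈ Finset.range T, (((ζ ^ r)⁻¹) ^ j) • (f ^ j) v =
      if j = 0 then (T : ℂ) • v else 0 := by
    intro j hj
    rw [← Finset.sum_smul]
    split_ifs with h0
    · subst h0
      simp
    · have h3 : ∀ r, ((ζ ^ r)⁻¹) ^ j = ((ζ ^ j)⁻¹) ^ r := by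
        intro r
        rw [inv_pow, inv_pow, ← pow_mul, ← pow_mul, mul_comm]
      have h4 : (ζ ^ j)⁻¹ ≠ 1 := by
        rw [Ne, inv_eq_one]
        exact hζ.pow_ne_one_of_pos_of_lt h0 (Finset.mem_range.1 hj)
      rw [Finset.sum_congr rfl fun r _ => h3 r, geom_sum_eq h4, inv_pow, ← pow_mul, mul_comm,
        pow_mul, hζ.pow_eq_one, one_pow, inv_one, sub_self, zero_div, zero_smul]
  rw [Finset.sum_comm, Finset.sum_congr rfl h2, Finset.sum_ite_eq' (Finset.range T) 0,
    if_pos (Finset.mem_range.2 (Nat.pos_of_ne_zero hT))] at h1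
  exact (Submodule.smul_mem_iff _ (Nat.cast_ne_zero.2 hT)).1 h1

end Module.End

/-- Used to solve a Jacobi identity for its `i = 0` term by induction. Finiteness is essential,
since a `finsum` with infinite support is `0` by convention. -/
theorem finsum_leading_mem {W : Type*} [AddCommGroup W] [Module ℂ W] (S : Submodule ℂ W)
    (f : ℕ → W) (hfin : ∃ M, ∀ i ≥ M, f i = 0) (hsum : ∑ᶠ i, f i ∈ S)
    (htail : ∀ i, f (i + 1) ∈ S) : f 0 ∈ S := by
  obtain ⟨M, hM⟩ := hfin
  have hsupp : Function.support f ⊆ (Finset.range (M + 1) : Finset ℕ) := by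
    intro i hi
    rw [Finset.coe_range, Set.mem_Iio]
    by_contra h
    exact hi (hM i (by omega))
  rw [finsum_eq_sum_of_support_subset f hsupp, Finset.sum_range_succ'] at hsum
  exact (Submodule.add_mem_iff_right _ (Submodule.sum_mem _ fun i _ => htail i)).1 hsum

theorem finsum_mem_submodule {W : Type*} [AddCommGroup W] [Module ℂ W] (S : Submodule ℂ W)
    (f : ℕ → W) (h : ∀ i, f i ∈ S) : ∑ᶠ i, f i ∈ S :=
  finsum_induction (· ∈ S) S.zero_mem (fun _ _ => S.add_mem) h

/-! ### Eigenspaces of the automorphism -/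

namespace VertexOperatorAlgebra

variable {V : Type u} [AddCommGroup V] [Module ℂ V] (A : VertexOperatorAlgebra V)

theorem exists_forall_ge_mode_eq_zero (a b : V) : ∃ K : ℤ, ∀ k ≥ K, A.mode a k b = 0 := by
  refine ⟨-HahnSeries.order ((HahnModule.of ℂ).symm (A.Y a b)), fun k hk => ?_⟩
  exact ncoeff_eq_zero_of_lt_order _ _ _ (by omega)

theorem eq_top_of_weight_le (S : Submodule ℂ V) (hS : ∀ n, A.weight n ≤ S) : S = ⊤ :=
  eq_top_iff.2 (A.iSup_weight ▸ iSup_le hS)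

variable {A}

theorem coe_pow_toLinearMap (g : A.aut) (n : ℕ) :
    (g : V ≃ₗ[ℂ] V).toLinearMap ^ n = ((g ^ n : A.aut) : V ≃ₗ[ℂ] V).toLinearMap := by
  induction n with
  | zero => rfl
  | succ n ih => rw [pow_succ, ih, pow_succ]; rfl

theorem isPrimitiveRoot_exp_orderOf {g : A.aut} (hg : IsOfFinOrder g) :
    IsPrimitiveRoot (Complex.exp (2 * Real.pi * Complex.I / orderOf g)) (orderOf g) :=
  Complex.isPrimitiveRoot_exp _ hg.orderOf_pos.ne'

theorem eigen_eq (g : A.aut) (r : ℕ) :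
    A.eigen g r = Module.End.eigenspace (g : V ≃ₗ[ℂ] V).toLinearMap
      (Complex.exp (2 * Real.pi * Complex.I / orderOf g) ^ r) := by
  rw [eigen, ← Complex.exp_nat_mul]
  congr 2
  ring

theorem eq_top_of_eigen_le {g : A.aut} (hg : IsOfFinOrder g) (S : Submodule ℂ V)
    (hS : ∀ r < orderOf g, A.eigen g r ≤ S) : S = ⊤ := by
  refine Module.End.eq_top_of_eigenspace_le (g : V ≃ₗ[ℂ] V).toLinearMap hg.orderOf_pos.ne' ?_
    (isPrimitiveRoot_exp_orderOf hg) S fun r hr => (eigen_eq g r).symm.le.trans (hS r hr)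
  rw [coe_pow_toLinearMap, pow_orderOf_eq_one]
  rfl

theorem eigen_zero_le_fixed (g : A.aut) : A.eigen g 0 ≤ A.fixed (Subgroup.zpowers g) := by
  intro a ha h hh
  have hga : (g : V ≃ₗ[ℂ] V) a = a := by
    have := Module.End.mem_eigenspace_iff.1 (eigen_eq g 0 ▸ ha)
    rwa [pow_zero, one_smul] at this
  have : Subgroup.zpowers g ≤ (MulAction.stabilizer (V ≃ₗ[ℂ] V) a).comap A.aut.subtype := by
    rw [Subgroup.zpowers_le]
    exact hga
  exact this hh

theorem fixed_le_eigen_zero (g : A.aut) : A.fixed (Subgroup.zpowers g) ≤ A.eigen g 0 := by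
  intro a ha
  rw [eigen_eq, Module.End.mem_eigenspace_iff, pow_zero, one_smul]
  exact ha g (Subgroup.mem_zpowers g)

/-- If products of nonzero eigenvectors do not all vanish, then all `|g|`-th roots of unity are
eigenvalues of `g`. -/
theorem eigen_ne_bot {g : A.aut} (hg : IsOfFinOrder g) (hV : Nontrivial V)
    (h : ∀ r < orderOf g, ∀ a ∈ A.eigen g r, a ≠ 0 →
      ∀ s < orderOf g, ∀ b ∈ A.eigen g s, b ≠ 0 → ∃ n, A.mode a n b ≠ 0)
    (r : ℕ) : A.eigen g r ≠ ⊥ := by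
  set ζ := Complex.exp (2 * Real.pi * Complex.I / orderOf g)
  have hζ : IsPrimitiveRoot ζ (orderOf g) := isPrimitiveRoot_exp_orderOf hg
  have hT := hg.orderOf_pos
  have : NeZero (orderOf g) := ⟨hT.ne'⟩
  let L : Module.End ℂ V := (g : V ≃ₗ[ℂ] V).toLinearMap
  have hLT : L ^ orderOf g = 1 := by
    rw [coe_pow_toLinearMap, pow_orderOf_eq_one]; rfl
  have hroot : ∀ μ : ℂ, L.eigenspace μ ≠ ⊥ → μ ^ orderOf g = 1 := by
    intro μ hμ
    obtain ⟨a, ha, ha0⟩ := (Submodule.ne_bot_iff _).1 hμ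
    have h1 : (L ^ orderOf g) a = μ ^ orderOf g • a :=
      Module.End.HasEigenvector.pow_apply ⟨ha, ha0⟩ _
    rw [hLT, Module.End.one_apply] at h1
    exact (smul_left_injective ℂ ha0 (by simpa using h1)).symm
  have hmul : ∀ μ ν : ℂ, L.eigenspace μ ≠ ⊥ → L.eigenspace ν ≠ ⊥ → L.eigenspace (μ * ν) ≠ ⊥ := by
    intro μ ν hμ hν
    obtain ⟨a, ha, ha0⟩ := (Submodule.ne_bot_iff _).1 hμ
    obtain ⟨b, hb, hb0⟩ := (Submodule.ne_bot_iff _).1 hν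
    obtain ⟨s, hs, rfl⟩ := hζ.eq_pow_of_pow_eq_one (hroot μ hμ)
    obtain ⟨t, ht, rfl⟩ := hζ.eq_pow_of_pow_eq_one (hroot ν hν)
    obtain ⟨n, hn⟩ := h s hs a (by rw [eigen_eq]; exact ha) ha0 t ht b
      (by rw [eigen_eq]; exact hb) hb0
    refine (Submodule.ne_bot_iff _).2 ⟨_, Module.End.mem_eigenspace_iff.2 ?_, hn⟩
    have ha' : (g : V ≃ₗ[ℂ] V) a = ζ ^ s • a := Module.End.mem_eigenspace_iff.1 ha
    have hb' : (g : V ≃ₗ[ℂ] V) b = ζ ^ t • b := Module.End.mem_eigenspace_iff.1 hb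
    change (g : V ≃ₗ[ℂ] V) _ = _
    rw [g.2.1, ha', hb', mode, map_smul, map_smul, map_smul, Pi.smul_apply, LinearMap.smul_apply,
      smul_smul, mul_comm]
    rfl
  have hone : L.eigenspace 1 ≠ ⊥ := by
    refine (Submodule.ne_bot_iff _).2 ⟨A.vac, Module.End.mem_eigenspace_iff.2 ?_, fun h0 => ?_⟩
    · rw [one_smul]; exact g.2.2.1
    · obtain ⟨x, hx⟩ := exists_ne (0 : V)
      apply hx
      have := A.vac_apply (-1) x
      rw [h0, map_zero, if_pos rfl] at this
      exact this.symm
  have hpow : ∀ (μ : ℂ) (n : ℕ), L.eigenspace μ ≠ ⊥ → L.eigenspace (μ ^ n) ≠ ⊥ := by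
    intro μ n hμ
    induction n with
    | zero => rwa [pow_zero]
    | succ n ih => rw [pow_succ]; exact hmul _ _ ih hμ
  -- The eigenvalues of `g`: closed under products by `hmul`, and under inverses because they are
  -- roots of unity.
  let Λ : Subgroup ℂˣ :=
    { carrier := {μ | L.eigenspace (μ : ℂ) ≠ ⊥}
      one_mem' := hone
      mul_mem' := fun {a b} ha hb => by
        change L.eigenspace ((a * b : ℂˣ) : ℂ) ≠ ⊥
        rw [Units.val_mul]
        exact hmul _ _ ha hb
      inv_mem' := fun {a} ha => by
        change L.eigenspace ((a⁻¹ : ℂˣ) : ℂ) ≠ ⊥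
        have : (a⁻¹ : ℂˣ) = a ^ (orderOf g - 1) := by
          rw [inv_eq_iff_mul_eq_one, ← pow_succ', Nat.sub_add_cancel hT]
          exact Units.ext (by rw [Units.val_pow_eq_pow_val, hroot _ ha, Units.val_one])
        rw [this, Units.val_pow_eq_pow_val]
        exact hpow _ _ ha }
  have hΛ : Λ ≤ rootsOfUnity (orderOf g) ℂ := by
    intro μ hμ
    rw [mem_rootsOfUnity]
    exact Units.ext (by rw [Units.val_pow_eq_pow_val, hroot _ hμ, Units.val_one])
  have : Finite Λ := Finite.of_injective _ (Subgroup.inclusion_injective hΛ)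
  -- By Lagrange's theorem every eigenvalue `μ` satisfies `μ ^ |Λ| = 1`; as `g` is diagonalizable,
  -- `g ^ |Λ| = 1`. So `Λ` is too large to be a proper subgroup of the roots of unity.
  have hdvd : orderOf g ∣ Nat.card Λ := by
    rw [orderOf_dvd_iff_pow_eq_one]
    have key : LinearMap.eqLocus (((g ^ Nat.card Λ : A.aut) : V ≃ₗ[ℂ] V).toLinearMap)
        (LinearMap.id) = ⊤ := by
      refine eq_top_of_eigen_le hg _ fun s _ a ha => ?_
      rw [eigen_eq] at ha
      rw [LinearMap.mem_eqLocus, LinearMap.id_apply]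
      by_cases ha0 : a = 0
      · rw [ha0, map_zero]
      have hs : L.eigenspace (ζ ^ s) ≠ ⊥ := (Submodule.ne_bot_iff _).2 ⟨a, ha, ha0⟩
      have h1 : (⟨Units.mk0 (ζ ^ s) (pow_ne_zero _ (hζ.ne_zero hT.ne')), hs⟩ : Λ) ^ Nat.card Λ
          = 1 := pow_card_eq_one'
      have h2 : (ζ ^ s) ^ Nat.card Λ = 1 := congrArg (fun x : Λ => ((x : ℂˣ) : ℂ)) h1
      rw [← coe_pow_toLinearMap,
        Module.End.HasEigenvector.pow_apply (f := L) (μ := ζ ^ s) ⟨ha, ha0⟩, h2, one_smul]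
    apply Subtype.ext
    apply LinearEquiv.ext
    intro x
    have : x ∈ LinearMap.eqLocus (((g ^ Nat.card Λ : A.aut) : V ≃ₗ[ℂ] V).toLinearMap)
        (LinearMap.id) := key ▸ Submodule.mem_top
    exact this
  have hcard : Λ = rootsOfUnity (orderOf g) ℂ := by
    refine Subgroup.eq_of_le_of_card_ge hΛ ?_
    exact (card_rootsOfUnity ℂ _).trans (Nat.le_of_dvd Nat.card_pos hdvd)
  rw [eigen_eq]
  have h1 : Units.mk0 (ζ ^ r) (pow_ne_zero _ (hζ.ne_zero hT.ne')) ∈ Λ := by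
    rw [hcard, mem_rootsOfUnity]
    refine Units.ext ?_
    rw [Units.val_pow_eq_pow_val, Units.val_mk0, ← pow_mul, mul_comm, pow_mul, hζ.pow_eq_one,
      one_pow, Units.val_one]
  exact h1

variable {g : A.aut}

/-! ### Generated submodules and annihilators in twisted modules -/

namespace WeakTwistedModule

variable {W : Type v} [AddCommGroup W] [Module ℂ W] (M : WeakTwistedModule A g W)

/-- Subspaces stable under all modes. -/
def IsStable (S : Submodule ℂ W) : Prop := ∀ (q : ℚ) (a : V), ∀ w ∈ S, M.act q a w ∈ S

/-- The span of all `a_(q) x` with `x ∈ X`. -/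
def gen (X : Submodule ℂ W) : Submodule ℂ W :=
  ⨆ (q : ℚ) (a : V), X.map (M.act q a)

theorem act_mem_gen {X : Submodule ℂ W} {x : W} (hx : x ∈ X) (q : ℚ) (a : V) :
    M.act q a x ∈ M.gen X :=
  (le_iSup₂_of_le q a le_rfl : X.map (M.act q a) ≤ M.gen X) (Submodule.mem_map_of_mem hx)

theorem gen_le {X S : Submodule ℂ W} (h : ∀ (q : ℚ) (a : V), ∀ x ∈ X, M.act q a x ∈ S) :
    M.gen X ≤ S :=
  iSup₂_le fun q a => Submodule.map_le_iff_le_comap.2 fun x hx => h q a x hx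

theorem gen_mono {X X' : Submodule ℂ W} (h : X ≤ X') : M.gen X ≤ M.gen X' :=
  M.gen_le fun q a _ hx => M.act_mem_gen (h hx) q a

theorem le_gen (X : Submodule ℂ W) : X ≤ M.gen X := by
  intro x hx
  have := M.act_mem_gen hx (-1) A.vac
  rwa [M.vac_act, if_pos rfl] at this

theorem gen_bot : M.gen ⊥ = ⊥ :=
  eq_bot_iff.2 <| M.gen_le fun q a x hx => by
    rw [(Submodule.mem_bot ℂ).1 hx, map_zero]; exact Submodule.zero_mem _

theorem IsStable.gen_le {M : WeakTwistedModule A g W} {X S : Submodule ℂ W} (hS : M.IsStable S)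
    (h : X ≤ S) : M.gen X ≤ S :=
  M.gen_le fun q a x hx => hS q a x (h hx)

theorem isStable_sSup {M : WeakTwistedModule A g W} {Z : Set (Submodule ℂ W)}
    (h : ∀ N ∈ Z, M.IsStable N) : M.IsStable (sSup Z) := by
  intro q a
  change sSup Z ≤ (sSup Z).comap (M.act q a)
  exact sSup_le fun N hN w hw => (le_sSup hN : N ≤ sSup Z) (h N hN q a w hw)

/-- If `a_(k+i) b` (in the twisted Jacobi identity with `m + k = p`) and `b a_(m+i) w` are
harmless, then so is `a_(p) b_(n) w`. -/
theorem act_act_mem (S : Submodule ℂ W) {r : ℕ} (hr : r < orderOf g) {a : V} (ha : a ∈ A.eigen g r)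
    (b : V) (w : W)
    (h : ∀ p : ℚ, (∃ l : ℤ, p = l + (r : ℚ) / orderOf g) → ∃ k : ℤ,
      (∀ (i : ℕ) (q : ℚ), M.act q (A.mode a (k + i) b) w ∈ S) ∧
      ∀ (i : ℕ) (n : ℚ), M.act n b (M.act (p - k + i) a w) ∈ S) (p n : ℚ) :
    M.act p a (M.act n b w) ∈ S := by
  obtain ⟨N, hN⟩ := M.truncation b w
  -- Descending induction on `n`, starting where `b_(n) w = 0`. The terms `i ≥ 1` contain `b_(n+i)
  -- w`, and their modes of `a` stay in the coset `r / |g| + ℤ`.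
  have key : ∀ (j : ℕ) (n : ℚ), N - j ≤ n → ∀ p : ℚ, (∃ l : ℤ, p = l + (r : ℚ) / orderOf g) →
      M.act p a (M.act n b w) ∈ S := by
    intro j
    induction j with
    | zero =>
      intro n hn p _
      rw [hN n (by simpa using hn), map_zero]
      exact S.zero_mem
    | succ j ih =>
      rintro n hn p ⟨l, hl⟩
      have hn' : ∀ i : ℕ, N - j ≤ n + ((i + 1 : ℕ) : ℚ) := by
        intro i
        push_cast at hn ⊢
        have : (0 : ℚ) ≤ i := Nat.cast_nonneg i
        linarith
      obtain ⟨k, hk1, hk2⟩ := h p ⟨l, hl⟩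
      -- With `m = p - k` the first term on the right is `a_(p) b_(n) w`, with coefficient `1`.
      have hjac := M.jacobi r hr a ha b w k (p - k) n ⟨l - k, by rw [hl]; push_cast; ring⟩
      have hsum : ∑ᶠ i : ℕ, ((-1) ^ i * ((Ring.choose k i : ℤ) : ℂ)) •
          (M.act (p - k + k - i) a (M.act (n + i) b w) -
          (-1 : ℂ) ^ k • M.act (n + k - i) b (M.act (p - k + i) a w)) ∈ S := by
        rw [← hjac]
        exact finsum_mem_submodule S _ fun i => S.smul_mem _ (hk1 i _)
      have h0 := finsum_leading_mem S _ ?_ hsum ?_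
      · rw [pow_zero, Ring.choose_zero_right, one_mul, Int.cast_one, one_smul, Nat.cast_zero,
          sub_zero, sub_add_cancel, add_zero] at h0
        refine (Submodule.sub_mem_iff_left _ (S.smul_mem _ ?_)).1 h0
        have := hk2 0 (n + k - (0 : ℚ))
        rwa [Nat.cast_zero] at this
      · obtain ⟨N', hN'⟩ := M.truncation a w
        refine ⟨max ⌈N - n⌉₊ ⌈N' - (p - k)⌉₊, fun i hi => ?_⟩
        have h1 : N - n ≤ i := Nat.ceil_le.1 ((le_max_left _ _).trans hi)
        have h2 : N' - (p - k) ≤ i := Nat.ceil_le.1 ((le_max_right _ _).trans hi)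
        rw [hN (n + i) (by linarith), hN' (p - k + i) (by linarith), map_zero, map_zero, smul_zero,
          sub_zero, smul_zero]
      · intro i
        refine S.smul_mem _ (S.sub_mem ?_ (S.smul_mem _ (hk2 _ _)))
        refine ih _ (hn' i) _ ⟨l - (i + 1), ?_⟩
        rw [hl]; push_cast; ring
  by_cases hp : ∃ l : ℤ, p = l + (r : ℚ) / orderOf g
  · refine key ⌈N - n⌉₊ n ?_ p hp
    linarith [Nat.le_ceil (N - n)]
  · rw [M.act_eq_zero r hr a ha p hp]
    exact S.zero_mem

/-- One application of modes suffices: the Jacobi identity rewrites `a_(p) b_(n) x` through modes of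
the products `a_(k) b` on `x`. By linearity `a` may be taken to be an eigenvector, where that
identity is available. -/
theorem isStable_gen (hg : IsOfFinOrder g) (X : Submodule ℂ W) : M.IsStable (M.gen X) := by
  intro p a
  suffices h : (⊤ : Submodule ℂ V) ≤
      ⨅ w : M.gen X, (M.gen X).comap ((M.act p).flip (w : W)) by
    intro w hw
    exact (Submodule.mem_iInf _).1 (h (Submodule.mem_top (x := a))) ⟨w, hw⟩
  rw [← eq_top_of_eigen_le hg _ ?_]
  intro r hr a ha
  rw [Submodule.mem_iInf]
  rintro ⟨w, hw⟩
  change w ∈ (M.gen X).comap (M.act p a)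
  refine M.gen_le ?_ hw
  intro n b x hx
  refine M.act_act_mem (M.gen X) hr ha b x (fun p _ => ?_) p n
  obtain ⟨N, hN⟩ := M.truncation a x
  -- With `k ≤ p - N` all the modes `a_(p-k+i)` kill `x`, so the terms in the opposite order vanish.
  refine ⟨⌊p - N⌋, fun i q => M.act_mem_gen hx _ _, fun i n => ?_⟩
  have h1 := Int.floor_le (p - N)
  have h2 : (0 : ℚ) ≤ i := Nat.cast_nonneg i
  rw [hN _ (by linarith), map_zero]
  exact Submodule.zero_mem _

/-- The annihilator modulo `P` of a stable subspace `U`. -/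
def annihilator (P U : Submodule ℂ W) : Submodule ℂ V :=
  ⨅ (q : ℚ) (u : U), P.comap ((M.act q).flip (u : W))

theorem mem_annihilator {P U : Submodule ℂ W} {a : V} :
    a ∈ M.annihilator P U ↔ ∀ (q : ℚ), ∀ u ∈ U, M.act q a u ∈ P := by
  simp [annihilator, Submodule.mem_iInf]

/-- This makes the annihilator an ideal. In the Jacobi identity for `b` and `a`, both orders of
modes map `U` into `P`, by stability of `P` and `U`. The left side is then solved for its leading
term by descending induction on `k`, starting where `b_(k) a = 0`. -/
theorem mode_mem_annihilator (hg : IsOfFinOrder g) {P U : Submodule ℂ W} (hP : M.IsStable P)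
    (hU : M.IsStable U) (b : V) (k : ℤ) {a : V} (ha : a ∈ M.annihilator P U) :
    A.mode b k a ∈ M.annihilator P U := by
  rw [mem_annihilator] at ha
  suffices h : (⊤ : Submodule ℂ V) ≤
      (M.annihilator P U).comap (((LinearMap.proj k ∘ₗ ncoeff) ∘ₗ A.Y).flip a) from
    h (Submodule.mem_top (x := b))
  rw [← eq_top_of_eigen_le hg _ ?_]
  intro r hr b hb
  change A.mode b k a ∈ M.annihilator P U
  obtain ⟨K, hK⟩ := A.exists_forall_ge_mode_eq_zero b a
  have key : ∀ (j : ℕ) (k : ℤ), K - j ≤ k → A.mode b k a ∈ M.annihilator P U := by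
    intro j
    induction j with
    | zero =>
      intro k hk
      rw [hK k (by simpa using hk)]
      exact Submodule.zero_mem _
    | succ j ih =>
      intro k hk
      rw [mem_annihilator]
      intro q u hu
      -- Any `m` in the coset would do; `n` is chosen to make `m + n = q`.
      have hjac := M.jacobi r hr b hb a u k ((r : ℚ) / orderOf g) (q - (r : ℚ) / orderOf g)
        ⟨0, by rw [Int.cast_zero, zero_add]⟩
      have hsum := finsum_mem_submodule P _ fun i : ℕ =>
        P.smul_mem (((-1) ^ i * ((Ring.choose k i : ℤ) : ℂ))) (P.sub_mem
          (hP ((r : ℚ) / orderOf g + k - i) b _ (ha (q - (r : ℚ) / orderOf g + i) u hu))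
          (P.smul_mem ((-1 : ℂ) ^ k) (ha (q - (r : ℚ) / orderOf g + k - i) _
            (hU ((r : ℚ) / orderOf g + i) b u hu))))
      rw [← hjac] at hsum
      have h0 := finsum_leading_mem P _ ?_ hsum ?_
      · rwa [Ring.choose_zero_right, Rat.cast_one, one_smul, Nat.cast_zero, Nat.cast_zero,
          sub_zero, add_zero, add_sub_cancel] at h0
      · refine ⟨(K - k).toNat, fun i hi => ?_⟩
        rw [hK (k + i) (by omega), map_zero, LinearMap.zero_apply, smul_zero]
      · intro i
        refine P.smul_mem _ (M.mem_annihilator.1 (ih (k + (i + 1 : ℕ)) ?_) _ u hu)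
        push_cast at hk ⊢
        omega
  exact key (K - k).toNat k (by omega)

/-- For a simple vertex operator algebra, a nonzero `a` acts nontrivially on every vector, also
modulo a submodule. -/
theorem mem_of_forall_act_mem (hg : IsOfFinOrder g) (hA : A.IsSimple) {P : Submodule ℂ W}
    (hP : M.IsStable P) {r : ℕ} (hr : r < orderOf g) {a : V} (ha : a ∈ A.eigen g r) (ha0 : a ≠ 0)
    {x : W} (hx : ∀ q, M.act q a x ∈ P) : x ∈ P := by
  set U := M.gen (Submodule.span ℂ {x})
  have hxU : x ∈ U := M.le_gen _ (Submodule.mem_span_singleton_self x)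
  have haI : a ∈ M.annihilator P U := by
    rw [mem_annihilator]
    intro p u hu
    change u ∈ P.comap (M.act p a)
    refine M.gen_le ?_ hu
    intro n b y hy
    obtain ⟨c, rfl⟩ := Submodule.mem_span_singleton.1 hy
    rw [map_smul]
    refine Submodule.smul_mem _ _ (M.act_act_mem P hr ha b x (fun p _ => ?_) p n)
    -- Locality: for `k ≥ K` the products `a_(k+i) b` vanish, and the remaining terms apply `b` to
    -- some `a_(q) x ∈ P`.
    obtain ⟨K, hK⟩ := A.exists_forall_ge_mode_eq_zero a b
    refine ⟨K, fun i q => ?_, fun i n => hP _ _ _ (hx _)⟩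
    rw [hK _ (by omega), map_zero]
    exact P.zero_mem
  -- The ideal contains `a ≠ 0`, so it is `V`; then it contains the vacuum, whose mode `-1` is the
  -- identity.
  rcases hA.2 (M.annihilator P U) fun b n c hc =>
    M.mode_mem_annihilator hg hP (M.isStable_gen hg _) b n hc with h | h
  · rw [h] at haI
    exact absurd ((Submodule.mem_bot ℂ).1 haI) ha0
  · have := M.mem_annihilator.1 (h ▸ Submodule.mem_top : A.vac ∈ M.annihilator P U) (-1) x hxU
    rwa [M.vac_act, if_pos rfl] at this

theorem isStable_bot : M.IsStable ⊥ := fun q a w hw => by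
  rw [(Submodule.mem_bot ℂ).1 hw, map_zero]; exact Submodule.zero_mem _

/-- If a simple vertex operator algebra has a nonzero twisted module then products of nonzero
vectors do not all vanish. -/
theorem exists_mode_ne_zero (M : WeakTwistedModule A g W) (hg : IsOfFinOrder g) (hA : A.IsSimple)
    {x : W} (hx : x ≠ 0) {r : ℕ} (hr : r < orderOf g) {a : V} (ha : a ∈ A.eigen g r) (ha0 : a ≠ 0) {s : ℕ}
    (hs : s < orderOf g) {b : V} (hb : b ∈ A.eigen g s) (hb0 : b ≠ 0) : ∃ n, A.mode a n b ≠ 0 := by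
  by_contra! hab
  -- If all products vanish, then all `a_(p) b_(n) x` do. Cancelling `a` and then `b` gives `x = 0`.
  refine hx ((Submodule.mem_bot ℂ).1 (M.mem_of_forall_act_mem hg hA M.isStable_bot hs hb hb0 ?_))
  intro n
  refine M.mem_of_forall_act_mem hg hA M.isStable_bot hr ha ha0 ?_
  intro p
  refine M.act_act_mem ⊥ hr ha b x (fun p _ => ?_) p n
  obtain ⟨N, hN⟩ := M.truncation a x
  refine ⟨⌊p - N⌋, fun i q => ?_, fun i n => ?_⟩
  · rw [hab, map_zero]
    exact Submodule.zero_mem _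
  · have h1 := Int.floor_le (p - N)
    have h2 : (0 : ℚ) ≤ i := Nat.cast_nonneg i
    rw [hN _ (by linarith), map_zero]
    exact Submodule.zero_mem _

end WeakTwistedModule

/-! ### Graded submodules -/

namespace AdmissibleTwistedModule

variable {W : Type v} [AddCommGroup W] [Module ℂ W] (M : AdmissibleTwistedModule A g W)

/-- The projection to `W(n)`. -/
def proj (n : ℚ) : W →ₗ[ℂ] W :=
  (M.grade n).subtype ∘ₗ DirectSum.component ℂ ℚ (fun n => M.grade n) n ∘ₗ
    (LinearEquiv.ofBijective (DirectSum.coeLinearMap M.grade) M.isInternal_grade).symm.toLinearMap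

theorem proj_mem (n : ℚ) (x : W) : M.proj n x ∈ M.grade n := Submodule.coe_mem _

theorem proj_of_mem {n : ℚ} {x : W} (hx : x ∈ M.grade n) : M.proj n x = x :=
  congrArg Subtype.val (M.isInternal_grade.ofBijective_coeLinearMap_of_mem hx)

theorem proj_of_mem_ne {m n : ℚ} (hmn : m ≠ n) {x : W} (hx : x ∈ M.grade m) : M.proj n x = 0 :=
  congrArg Subtype.val (M.isInternal_grade.ofBijective_coeLinearMap_of_mem_ne hmn hx)

theorem mem_of_proj_mem {S : Submodule ℂ W} {x : W} (h : ∀ n, M.proj n x ∈ S) : x ∈ S := by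
  classical
  have hx := (LinearEquiv.ofBijective (DirectSum.coeLinearMap M.grade)
    M.isInternal_grade).apply_symm_apply x
  rw [← hx]
  change DirectSum.coeLinearMap M.grade _ ∈ S
  rw [DirectSum.coeLinearMap_eq_dfinsuppSum]
  exact dfinsuppSum_mem _ _ _ fun n _ => h n

theorem eq_iSup_inf_grade_iff {N : Submodule ℂ W} :
    N = ⨆ n : ℚ, N ⊓ M.grade n ↔ ∀ x ∈ N, ∀ n, M.proj n x ∈ N := by
  constructor
  · intro h x hx n
    have : (⨆ m : ℚ, N ⊓ M.grade m) ≤ N.comap (M.proj n) := by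
      refine iSup_le fun m y hy => ?_
      rw [Submodule.mem_comap]
      by_cases hmn : m = n
      · subst hmn
        rw [M.proj_of_mem hy.2]
        exact hy.1
      · rw [M.proj_of_mem_ne hmn hy.2]
        exact N.zero_mem
    exact this (h ▸ hx)
  · intro h
    refine le_antisymm (fun x hx => M.mem_of_proj_mem fun n => ?_) (iSup_le fun n => inf_le_left)
    exact Submodule.mem_iSup_of_mem n ⟨h x hx n, M.proj_mem n x⟩

theorem IsSubmodule.inf {M : AdmissibleTwistedModule A g W} {N N' : Submodule ℂ W}
    (h : M.IsSubmodule N) (h' : M.IsSubmodule N') : M.IsSubmodule (N ⊓ N') where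
  act_mem q a w hw := ⟨h.act_mem q a w hw.1, h'.act_mem q a w hw.2⟩
  graded := M.eq_iSup_inf_grade_iff.2 fun x hx n =>
    ⟨M.eq_iSup_inf_grade_iff.1 h.graded x hx.1 n, M.eq_iSup_inf_grade_iff.1 h'.graded x hx.2 n⟩

theorem isSubmodule_sSup {Z : Set (Submodule ℂ W)} (h : ∀ N ∈ Z, M.IsSubmodule N) :
    M.IsSubmodule (sSup Z) where
  act_mem := M.isStable_sSup fun N hN => (h N hN).act_mem
  graded := M.eq_iSup_inf_grade_iff.2 fun x hx n => by
    have : sSup Z ≤ (sSup Z).comap (M.proj n) := sSup_le fun N hN y hy =>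
      (le_sSup hN : N ≤ sSup Z) (M.eq_iSup_inf_grade_iff.1 (h N hN).graded y hy n)
    exact this hx

/-- Vectors of `V` change degrees by the negative of the mode up to integers. -/
theorem act_mem_of_grade_le {S : Submodule ℂ W} {q n : ℚ} (h : ∀ l : ℤ, M.grade (n - q + l) ≤ S)
    (a : V) {x : W} (hx : x ∈ M.grade n) : M.act q a x ∈ S := by
  suffices ht : (⊤ : Submodule ℂ V) ≤ S.comap ((M.act q).flip x) from
    ht (Submodule.mem_top (x := a))
  rw [← A.eq_top_of_weight_le _ fun d => ?_]
  intro b hb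
  have := M.act_mem_grade d b hb q n x hx
  refine h (d - 1) ?_
  convert this using 2
  · push_cast
    ring
  · rfl

theorem isSubmodule_gen (hg : IsOfFinOrder g) {X : Submodule ℂ W}
    (hX : X = ⨆ n : ℚ, X ⊓ M.grade n) : M.IsSubmodule (M.gen X) where
  act_mem := M.isStable_gen hg X
  graded := by
    refine le_antisymm (M.gen_le fun q a x hx => ?_) (iSup_le fun n => inf_le_left)
    have h1 : (⨆ n : ℚ, X ⊓ M.grade n) ≤
        (⨆ n : ℚ, M.gen X ⊓ M.grade n).comap (M.act q a) := by
      refine iSup_le fun n y hy => ?_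
      suffices ht : (⊤ : Submodule ℂ V) ≤
          (⨆ n : ℚ, M.gen X ⊓ M.grade n).comap ((M.act q).flip y) from
        ht (Submodule.mem_top (x := a))
      rw [← A.eq_top_of_weight_le _ fun d => ?_]
      intro b hb
      exact Submodule.mem_iSup_of_mem (n + d - q - 1)
        ⟨M.act_mem_gen hy.1 q b, M.act_mem_grade d b hb q n y hy.2⟩
    exact h1 (hX ▸ hx)

/-! ### Integral and nonintegral degrees -/

/-- The sum of the `W(n)` with `n` an integer. -/
def integralPart : Submodule ℂ W := ⨆ n ∈ Set.range (Int.cast : ℤ → ℚ), M.grade n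

/-- The sum of the `W(n)` with `n` not an integer. -/
def nonintegralPart : Submodule ℂ W := ⨆ n ∈ (Set.range (Int.cast : ℤ → ℚ))ᶜ, M.grade n

theorem disjoint_integralPart : Disjoint M.nonintegralPart M.integralPart :=
  M.isInternal_grade.submodule_iSupIndep.disjoint_biSup_biSup disjoint_compl_left

theorem grade_le_integralPart (l : ℤ) : M.grade l ≤ M.integralPart :=
  le_iSup₂_of_le (l : ℚ) ⟨l, rfl⟩ le_rfl

theorem grade_le_nonintegralPart {n : ℚ} (hn : ¬ ∃ l : ℤ, (l : ℚ) = n) :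
    M.grade n ≤ M.nonintegralPart :=
  le_iSup₂_of_le n hn le_rfl

theorem integralPart_le {S : Submodule ℂ W} (h : ∀ l : ℤ, M.grade l ≤ S) : M.integralPart ≤ S := by
  refine iSup₂_le ?_
  rintro _ ⟨l, rfl⟩
  exact h l

theorem act_mem_integralPart {r : ℕ} (hr : r < orderOf g) {a : V} (ha : a ∈ A.eigen g r) {n : ℚ}
    (hn : ∃ l : ℤ, n = l + (r : ℚ) / orderOf g) {x : W} (hx : x ∈ M.grade n) (q : ℚ) :
    M.act q a x ∈ M.integralPart := by
  by_cases hq : ∃ l : ℤ, q = l + (r : ℚ) / orderOf g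
  · obtain ⟨l, rfl⟩ := hn
    obtain ⟨l', rfl⟩ := hq
    refine M.act_mem_of_grade_le (fun m => ?_) a hx
    convert M.grade_le_integralPart (l - l' + m) using 2
    push_cast
    ring
  · rw [M.act_eq_zero r hr a ha q hq]
    exact Submodule.zero_mem _

theorem fixed_act_mem_integralPart (hg : IsOfFinOrder g) {a : V}
    (ha : a ∈ A.fixed (Subgroup.zpowers g)) (q : ℚ) {x : W} (hx : x ∈ M.integralPart) :
    M.act q a x ∈ M.integralPart := by
  suffices h : M.integralPart ≤ M.integralPart.comap (M.act q a) from h hx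
  refine M.integralPart_le fun l y hy => ?_
  exact M.act_mem_integralPart hg.orderOf_pos (fixed_le_eigen_zero g ha) ⟨l, by simp⟩ hy q

/-- Only modes `q ∈ r / |g| + ℤ` occur, and they change degrees by `-r / |g|` modulo `ℤ`; this is
not an integer because `0 < r / |g| < 1`. -/
theorem act_mem_nonintegralPart {r : ℕ} (hr : r < orderOf g) (hr0 : r ≠ 0) {a : V}
    (ha : a ∈ A.eigen g r) (q : ℚ) {x : W} (hx : x ∈ M.integralPart) :
    M.act q a x ∈ M.nonintegralPart := by
  suffices h : M.integralPart ≤ M.nonintegralPart.comap (M.act q a) from h hx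
  refine M.integralPart_le fun l y hy => ?_
  rw [Submodule.mem_comap]
  by_cases hq : ∃ l : ℤ, q = l + (r : ℚ) / orderOf g
  · obtain ⟨l', rfl⟩ := hq
    refine M.act_mem_of_grade_le (fun m => M.grade_le_nonintegralPart ?_) a hy
    rintro ⟨s, hs⟩
    have hT : (0 : ℚ) < orderOf g := Nat.cast_pos.2 (by omega)
    have h1 : (r : ℚ) / orderOf g = ((l - l' + m - s : ℤ) : ℚ) := by
      push_cast
      linarith
    have h2 : (0 : ℚ) < (r : ℚ) / orderOf g := div_pos (Nat.cast_pos.2 (by omega)) hT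
    have h3 : (r : ℚ) / orderOf g < 1 := (div_lt_one hT).2 (Nat.cast_lt.2 hr)
    rw [h1] at h2 h3
    have h4 : 0 < l - l' + m - s := by exact_mod_cast h2
    have h5 : l - l' + m - s < 1 := by exact_mod_cast h3
    omega
  · rw [M.act_eq_zero r hr a ha q hq]
    exact Submodule.zero_mem _

/-- A `V^g`-stable subspace of the integral part is recovered from the `V`-submodule generated. -/
theorem gen_inf_integralPart (hg : IsOfFinOrder g) {X : Submodule ℂ W} (hX : X ≤ M.integralPart)
    (hX' : ∀ q, ∀ a ∈ A.fixed (Subgroup.zpowers g), ∀ x ∈ X, M.act q a x ∈ X) :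
    M.gen X ⊓ M.integralPart ≤ X := by
  have h1 : M.gen X ≤ X ⊔ M.nonintegralPart := by
    refine M.gen_le fun q a x hx => ?_
    suffices ht : (⊤ : Submodule ℂ V) ≤
        (X ⊔ M.nonintegralPart).comap ((M.act q).flip x) from
      ht (Submodule.mem_top (x := a))
    rw [← eq_top_of_eigen_le hg _ fun r hr b hb => ?_]
    change M.act q b x ∈ X ⊔ M.nonintegralPart
    by_cases hr0 : r = 0
    · subst hr0
      exact Submodule.mem_sup_left (hX' q b (eigen_zero_le_fixed g hb) x hx)
    · exact Submodule.mem_sup_right (M.act_mem_nonintegralPart hr hr0 hb q (hX hx))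
  -- The modular law applies since `X` lies in the integral part, which meets the nonintegral part
  -- in `0`.
  refine (inf_le_inf_right _ h1).trans ?_
  rw [sup_inf_assoc_of_le _ hX, M.disjoint_integralPart.eq_bot, sup_bot_eq]

/-- If `V` is simple then a submodule is generated by its integral part. -/
theorem IsSubmodule.le_gen_inf_integralPart {M : AdmissibleTwistedModule A g W}
    (hg : IsOfFinOrder g) (hA : A.IsSimple) {N : Submodule ℂ W} (hN : M.IsSubmodule N) :
    N ≤ M.gen (N ⊓ M.integralPart) := by
  refine hN.graded.le.trans (iSup_le fun n x hx => ?_)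
  by_cases hn : ∃ k : ℕ, n = (k : ℚ) / orderOf g
  swap
  · rw [M.grade_eq_bot n hn] at hx
    rw [(Submodule.mem_bot ℂ).1 hx.2]
    exact Submodule.zero_mem _
  obtain ⟨k, hk⟩ := hn
  by_cases hx0 : x = 0
  · rw [hx0]
    exact Submodule.zero_mem _
  have hT := hg.orderOf_pos
  have hr := Nat.mod_lt k hT
  -- The nonzero vector `x` itself supplies the nonzero twisted module from which nonvanishing of
  -- products in `V` is deduced.
  obtain ⟨a, ha, ha0⟩ := (Submodule.ne_bot_iff _).1 (eigen_ne_bot hg hA.1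
    (fun r hr a ha ha0 s hs b hb hb0 => M.exists_mode_ne_zero hg hA hx0 hr ha ha0 hs hb hb0)
    (k % orderOf g))
  -- As `x` has degree in `r / |g| + ℤ` with `r = k % |g|`, every `a_(q) x` has integral degrees and
  -- so lies in the generating subspace.
  refine M.mem_of_forall_act_mem hg hA (M.isStable_gen hg _) hr ha ha0 fun q => ?_
  refine M.le_gen _ ⟨hN.act_mem q a x hx.1, M.act_mem_integralPart hr ha ⟨(k / orderOf g : ℕ), ?_⟩
    hx.2 q⟩
  rw [hk, Int.cast_natCast, eq_comm]
  have hT' : (orderOf g : ℚ) ≠ 0 := Nat.cast_ne_zero.2 hT.ne'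
  rw [eq_div_iff hT', add_mul, div_mul_cancel₀ _ hT']
  exact_mod_cast Nat.div_add_mod' k (orderOf g)

/-! ### The integral part as a module for the orbifold -/

/-- The action of `V^g` on the integral part. -/
def integralAct (hg : IsOfFinOrder g) (q : ℚ) :
    A.fixed (Subgroup.zpowers g) →ₗ[ℂ] Module.End ℂ M.integralPart where
  toFun a := (M.act q (a : V)).restrict fun _ hx => M.fixed_act_mem_integralPart hg a.2 q hx
  map_add' a b := by
    ext x
    change M.act q ((a : V) + b) (x : W) = M.act q (a : V) x + M.act q (b : V) x
    rw [map_add, LinearMap.add_apply]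
  map_smul' c a := by
    ext x
    change M.act q (c • (a : V)) (x : W) = c • M.act q (a : V) x
    rw [map_smul, LinearMap.smul_apply]

theorem coe_integralAct (hg : IsOfFinOrder g) (q : ℚ) (a : A.fixed (Subgroup.zpowers g))
    (x : M.integralPart) : ((M.integralAct hg q a x : M.integralPart) : W) = M.act q (a : V) x :=
  rfl

theorem isInternal_comap_integralPart :
    DirectSum.IsInternal fun n => (M.grade n).comap M.integralPart.subtype := by
  refine DirectSum.isInternal_submodule_of_iSupIndep_of_iSup_eq_top ?_ ?_
  · rw [iSupIndep_iff_finsetSum_eq_zero_imp_eq_zero]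
    intro s v hv h0 i hi
    refine Subtype.ext ?_
    refine (iSupIndep_iff_finsetSum_eq_zero_imp_eq_zero _).1
      M.isInternal_grade.submodule_iSupIndep s (fun i => (v i : W)) (fun i hi => hv i hi) ?_ i hi
    have := congrArg M.integralPart.subtype h0
    rwa [map_sum, map_zero] at this
  · have h : M.integralPart ≤
        (⨆ n, (M.grade n).comap M.integralPart.subtype).map M.integralPart.subtype := by
      refine M.integralPart_le fun l x hx => ?_
      exact ⟨⟨x, M.grade_le_integralPart l hx⟩, Submodule.mem_iSup_of_mem (l : ℚ) hx, rfl⟩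
    rw [eq_top_iff]
    rintro x -
    obtain ⟨y, hy, hyx⟩ := h x.2
    rwa [← Subtype.ext hyx]

/-- The integral part of an admissible `g`-twisted `V`-module as an admissible untwisted module for
the orbifold `V^g`. -/
def integralModule (hg : IsOfFinOrder g) :
    AdmissibleTwistedModule (A.orbifold (Subgroup.zpowers g)) 1 M.integralPart where
  act := M.integralAct hg
  act_eq_zero r hr a _ q hq := by
    rw [orderOf_one, Nat.lt_one_iff] at hr
    subst hr
    ext x
    rw [coe_integralAct, LinearMap.zero_apply, Submodule.coe_zero]
    rw [M.act_eq_zero 0 hg.orderOf_pos a (fixed_le_eigen_zero g a.2) q, LinearMap.zero_apply]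
    simpa using hq
  truncation a x := by
    obtain ⟨N, hN⟩ := M.truncation (a : V) (x : W)
    exact ⟨N, fun q hq => Subtype.ext (hN q hq)⟩
  vac_act q x := by
    refine Subtype.ext ?_
    rw [coe_integralAct]
    refine (M.vac_act q x).trans ?_
    split_ifs <;> rfl
  jacobi r hr a _ b x k m n hm := by
    rw [orderOf_one, Nat.lt_one_iff] at hr
    subst hr
    refine Subtype.ext ?_
    rw [coe_finsum, coe_finsum]
    exact M.jacobi 0 hg.orderOf_pos a (fixed_le_eigen_zero g a.2) b x k m n (by simpa using hm)
  grade n := (M.grade n).comap M.integralPart.subtype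
  isInternal_grade := M.isInternal_comap_integralPart
  grade_eq_bot n hn := by
    rw [eq_bot_iff]
    intro x hx
    refine (Submodule.mem_bot ℂ).2 (Subtype.ext ?_)
    rw [Submodule.coe_zero]
    -- Two cases: a negative integral degree is already empty in `W`, and a nonintegral piece meets
    -- the integral part in `0`.
    by_cases hZ : ∃ l : ℤ, (l : ℚ) = n
    · obtain ⟨l, rfl⟩ := hZ
      rw [Submodule.mem_comap, M.grade_eq_bot] at hx
      · exact (Submodule.mem_bot ℂ).1 hx
      · rintro ⟨k, hk⟩
        have h0 : (0 : ℚ) ≤ l := by rw [hk]; positivity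
        have h1 : 0 ≤ l := by exact_mod_cast h0
        refine hn ⟨l.toNat, ?_⟩
        rw [orderOf_one, Nat.cast_one, div_one]
        exact_mod_cast (Int.toNat_of_nonneg h1).symm
    · exact (Submodule.mem_bot ℂ).1 (M.disjoint_integralPart.le_bot
        ⟨M.grade_le_nonintegralPart hZ hx, x.2⟩)
  act_mem_grade d a ha q n x hx := by
    refine M.act_mem_grade d (a : V) ?_ q n x hx
    exact Module.End.mem_eigenspace_iff.2
      (congrArg Subtype.val (Module.End.mem_eigenspace_iff.1 ha))

/-! ### Transfer of submodules and complete reducibility -/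

variable {M}

/-- The `V`-submodule generated by a `V^g`-submodule of the integral part. -/
theorem isSubmodule_gen_map (hg : IsOfFinOrder g) {N : Submodule ℂ M.integralPart}
    (hN : (M.integralModule hg).IsSubmodule N) :
    M.IsSubmodule (M.gen (N.map M.integralPart.subtype)) := by
  refine M.isSubmodule_gen hg (le_antisymm ?_ (iSup_le fun _ => inf_le_left))
  rw [Submodule.map_le_iff_le_comap]
  refine hN.graded.le.trans (iSup_le fun n x hx => ?_)
  exact Submodule.mem_iSup_of_mem n ⟨Submodule.mem_map_of_mem hx.1, hx.2⟩

theorem gen_map_inf_integralPart (hg : IsOfFinOrder g) {N : Submodule ℂ M.integralPart}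
    (hN : (M.integralModule hg).IsSubmodule N) :
    M.gen (N.map M.integralPart.subtype) ⊓ M.integralPart ≤ N.map M.integralPart.subtype := by
  refine M.gen_inf_integralPart hg (Submodule.map_subtype_le _ _) ?_
  rintro q a ha _ ⟨x, hx, rfl⟩
  exact ⟨_, hN.act_mem q ⟨a, ha⟩ x hx, rfl⟩

/-- The integral part of a `V`-submodule is a `V^g`-submodule. -/
theorem IsSubmodule.comap_integralPart (hg : IsOfFinOrder g) {N : Submodule ℂ W}
    (hN : M.IsSubmodule N) :
    (M.integralModule hg).IsSubmodule (N.comap M.integralPart.subtype) where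
  act_mem q a x hx := hN.act_mem q (a : V) x hx
  graded := (M.integralModule hg).eq_iSup_inf_grade_iff.2 fun x hx n => by
    have key : ∀ y : M.integralPart,
        (((M.integralModule hg).proj n y : M.integralPart) : W) = M.proj n (y : W) := by
      intro y
      suffices h : (⊤ : Submodule ℂ M.integralPart) ≤
          LinearMap.eqLocus (M.integralPart.subtype ∘ₗ (M.integralModule hg).proj n)
            (M.proj n ∘ₗ M.integralPart.subtype) from h (Submodule.mem_top (x := y))
      rw [← (M.integralModule hg).isInternal_grade.submodule_iSup_eq_top]
      refine iSup_le fun m z hz => ?_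
      change (((M.integralModule hg).proj n z : M.integralPart) : W) = M.proj n (z : W)
      have hz' : (z : W) ∈ M.grade m := hz
      by_cases hmn : m = n
      · subst hmn
        rw [proj_of_mem _ hz, proj_of_mem _ hz']
      · rw [proj_of_mem_ne _ hmn hz, proj_of_mem_ne _ hmn hz', Submodule.coe_zero]
    rw [Submodule.mem_comap, Submodule.coe_subtype, key]
    exact M.eq_iSup_inf_grade_iff.1 hN.graded x hx n

/-- A submodule `N'` of the generated module has its integral part inside `N`, hence equal to `0` or
`N`. Since `N'` is generated by its integral part, it is `0` or everything. -/
theorem IsIrreducibleSubmodule.gen_map (hg : IsOfFinOrder g) (hA : A.IsSimple)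
    {N : Submodule ℂ M.integralPart} (hN : (M.integralModule hg).IsIrreducibleSubmodule N) :
    M.IsIrreducibleSubmodule (M.gen (N.map M.integralPart.subtype)) where
  isSubmodule := isSubmodule_gen_map hg hN.isSubmodule
  ne_bot h := hN.ne_bot <| by
    have h1 : N.map M.integralPart.subtype ≤ ⊥ := h ▸ M.le_gen _
    rw [eq_bot_iff]
    intro x hx
    exact Subtype.ext ((Submodule.mem_bot ℂ).1 (h1 (Submodule.mem_map_of_mem hx)))
  eq_bot_or_eq N' hle hN' := by
    have h1 : N'.comap M.integralPart.subtype ≤ N := by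
      intro x hx
      obtain ⟨y, hy, hyx⟩ := gen_map_inf_integralPart hg hN.isSubmodule ⟨hle hx, x.2⟩
      rwa [← Subtype.ext hyx]
    have h2 := hN'.le_gen_inf_integralPart hg hA
    have h3 : N' ⊓ M.integralPart ≤
        (N'.comap M.integralPart.subtype).map M.integralPart.subtype :=
      fun x hx => ⟨⟨x, hx.2⟩, hx.1, rfl⟩
    rcases hN.eq_bot_or_eq _ h1 (hN'.comap_integralPart hg) with h | h
    · left
      rw [h, Submodule.map_bot] at h3
      exact le_bot_iff.1 (h2.trans ((M.gen_mono h3).trans M.gen_bot.le))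
    · right
      refine le_antisymm hle (WeakTwistedModule.IsStable.gen_le hN'.act_mem ?_)
      rw [Submodule.map_le_iff_le_comap, h]

/-- Both independence and spanning are tested on integral parts, which generate every submodule. -/
theorem isCompletelyReducible_of_integralModule (hg : IsOfFinOrder g) (hA : A.IsSimple)
    (h : (M.integralModule hg).IsCompletelyReducible) : M.IsCompletelyReducible := by
  obtain ⟨S, hS, hind, htop⟩ := h
  let F : Submodule ℂ M.integralPart → Submodule ℂ W := fun N =>
    M.gen (N.map M.integralPart.subtype)
  refine ⟨F '' S, ?_, ?_, ?_⟩
  · rintro _ ⟨N, hN, rfl⟩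
    exact (hS N hN).gen_map hg hA
  · rintro _ ⟨N, hN, rfl⟩
    have hZ : M.IsSubmodule (sSup (F '' S \ {F N})) := by
      refine M.isSubmodule_sSup ?_
      rintro _ ⟨⟨N', hN', rfl⟩, -⟩
      exact isSubmodule_gen_map hg (hS N' hN').isSubmodule
    have hD := (isSubmodule_gen_map hg (hS N hN).isSubmodule).inf hZ
    have hsub : (M.integralModule hg).IsSubmodule (sSup (S \ {N})) :=
      isSubmodule_sSup _ fun N' hN' => (hS N' hN'.1).isSubmodule
    -- Bounding the sum of the other modules by a single generated module lets its integral part be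
    -- computed as `sSup (S \ {N})`.
    have hle : sSup (F '' S \ {F N}) ≤ F (sSup (S \ {N})) := by
      refine sSup_le ?_
      rintro _ ⟨⟨N', hN', rfl⟩, hne⟩
      refine M.gen_mono (Submodule.map_mono (le_sSup ⟨hN', ?_⟩))
      rintro rfl
      exact hne rfl
    rw [disjoint_iff_inf_le]
    -- The integral part of the intersection lies in `N ⊓ sSup (S \ {N}) = ⊥`, and it generates the
    -- intersection.
    refine (hD.le_gen_inf_integralPart hg hA).trans ((M.gen_mono ?_).trans M.gen_bot.le)
    rintro x ⟨⟨hx1, hx2⟩, hx3⟩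
    obtain ⟨y, hy, rfl⟩ := gen_map_inf_integralPart hg (hS N hN).isSubmodule ⟨hx1, hx3⟩
    obtain ⟨z, hz, hzy⟩ := gen_map_inf_integralPart hg hsub ⟨hle hx2, hx3⟩
    have hzy' : z = y := Subtype.ext hzy
    rw [hzy'] at hz
    have := (hind hN).le_bot ⟨hy, hz⟩
    rw [(Submodule.mem_bot ℂ).1 this, map_zero]
    exact Submodule.zero_mem _
  · have hst : M.IsStable (sSup (F '' S)) := by
      refine M.isStable_sSup ?_
      rintro _ ⟨N, hN, rfl⟩
      exact M.isStable_gen hg _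
    have h1 : M.integralPart ≤ sSup (F '' S) := by
      have h2 : sSup S ≤ (sSup (F '' S)).comap M.integralPart.subtype :=
        sSup_le fun N hN => Submodule.map_le_iff_le_comap.1
          ((M.le_gen _).trans (le_sSup ⟨N, hN, rfl⟩))
      rw [htop] at h2
      exact fun x hx => h2 (Submodule.mem_top (x := ⟨x, hx⟩))
    have htop' : M.IsSubmodule ⊤ :=
      ⟨fun _ _ _ _ => Submodule.mem_top, M.eq_iSup_inf_grade_iff.2 fun _ _ _ => Submodule.mem_top⟩
    exact top_le_iff.1 ((htop'.le_gen_inf_integralPart hg hA).trans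
      (hst.gen_le (inf_le_right.trans h1)))

end AdmissibleTwistedModule

end VertexOperatorAlgebra

end

theorem mainTheorem6 {V : Type u} [AddCommGroup V] [Module ℂ V]
    (A : VertexOperatorAlgebra V) (hA : A.IsSimple)
    (g : A.aut) (hg : IsOfFinOrder g)
    (hrat : VertexOperatorAlgebra.IsRational.{u, max u v} (A.orbifold (Subgroup.zpowers g))) :
    VertexOperatorAlgebra.IsTwistedRational.{u, max u v} A g := by
  intro W _ _ M
  exact VertexOperatorAlgebra.AdmissibleTwistedModule.isCompletelyReducible_of_integralModule hg hA
    (hrat _ (M.integralModule hg))
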